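/- Let $n\ge 2$, $\alpha\in(0,1)$. For a sample $x_1,\dots,x_n\in\mathbb R^2$ put $\hat\mu=\frac1n\sum_i x_i$ and let $\hat C$ be the $2\times2$ matrix with entries $\hat c_{jk}=\frac1n\,\frac1{n-1}\sum_{i}(x_{i,j}-\hat\mu_j)(x_{i,k}-\hat\mu_k)$. Let $q$ be the $(1-\alpha/2)$-quantile of the Student $t$-distribution with $n-1$ degrees of freedom. Let $E=E(\hat C,\hat\mu,q)$ be the covariance ellipse: the ellipse centred at $\hat\mu$ whose principal axes point along orthonormal eigenvectors of $\hat C$ and whose semi-axes have lengths $q\sqrt{\lambda_1},q\sqrt{\lambda_2}$, where $\lambda_1,\lambda_2\ge 0$ are the corresponding eigenvalues (if $\hat C$ is invertible, $E=\{z:(z-\hat\mu)^{\mathsf T}\hat C^{-1}(z-\hat\mu)=q^2\}$; if $\hat C$ is singular, $E$ is a segment or a point). Define $R_{\mathrm{geo}}=R_{\mathrm{geo}}(x_1,\dots,x_n)\subseteq\mathbb R$ as follows. If the origin lies inside or on $E$, then $R_{\mathrm{geo}}=\mathbb R$. Otherwise let $W$ be the wedge enclosed by the two tangents to $E$ through the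 origin, that is, the double cone consisting of the closed sector between the two tangents which contains $E$ and of the opposite sector (a tangent through the origin being a line through the origin that meets $E$ and has $E$ on one side; if there are not two distinct such tangents, $W=\emptyset$), and let $R_{\mathrm{geo}}=\{r\in\mathbb R:(1,r)\in W\}$. Theorem. Let $Z_1,\dots,Z_n$ be i.i.d. random vectors with the bivariate normal distribution $N(\mu,C)$, where $\mu=(\mu_1,\mu_2)\in\mathbb R^2$ with $\mu_1\neq0$ and $C$ is a symmetric positive definite $2\times 2$ matrix, and let $\rho=\mu_2/\mu_1$. Then $R_{\mathrm{geo}}$ is an exact confidence region of level $1-\alpha$ for $\rho$: for all such $\mu$ and $C$, the set $\{\rho\in R_{\mathrm{geo}}(Z_1,\dots,Z_n)\}$ is an event (up to a null set) and $$P\bigl(\rho\in R_{\mathrm{geo}}(Z_1,\dots,Z_n)\bigr)=1-\alpha .$$ -/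

import Mathlib

open MeasureTheory ProbabilityTheory
open scoped Matrix

noncomputable section

namespace FiellerGeo

/-- The Euclidean plane. -/
abbrev Plane : Type := EuclideanSpace ℝ (Fin 2)

/-- Student's t-distribution with `f` degrees of freedom: the law of
`Z₀ / √((Z₁² + ⋯ + Z_f²) / f)` for independent standard normal `Z₀, Z₁, …, Z_f`. -/
def studentT (f : ℕ) : Measure ℝ :=
  ((gaussianReal 0 1).prod (Measure.pi fun _ : Fin f => gaussianReal 0 1)).map
    fun z => z.1 / √((∑ i, z.2 i ^ 2) / (f : ℝ))

/-- The `p`-quantile of a law on `ℝ`: the smallest `x` with `F x = p`, where `F` is the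
distribution function. -/
def quantile (ν : Measure ℝ) (p : ℝ) : ℝ :=
  sInf {x : ℝ | cdf ν x = p}

/-- The sample mean `μ̂`. -/
def sampleMean {n : ℕ} (x : Fin n → Plane) : Plane :=
  (1 / (n : ℝ)) • ∑ i, x i

/-- The estimated covariance matrix `Ĉ` (of the sample mean):
`ĉ_{jk} = (1 / n) (1 / (n - 1)) ∑ i, (x_{i,j} - μ̂_j) (x_{i,k} - μ̂_k)`. -/
def sampleCov {n : ℕ} (x : Fin n → Plane) : Matrix (Fin 2) (Fin 2) ℝ :=
  Matrix.of fun j k =>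
    (1 / (n : ℝ)) * (1 / ((n : ℝ) - 1)) *
      ∑ i, (x i j - sampleMean x j) * (x i k - sampleMean x k)

/-- `IsEigenSystem C v l`: the orthonormal basis `v` consists of eigenvectors of `C`, with
eigenvalues `l`. -/
def IsEigenSystem (C : Matrix (Fin 2) (Fin 2) ℝ) (v : OrthonormalBasis (Fin 2) ℝ Plane)
    (l : Fin 2 → ℝ) : Prop :=
  ∀ i, Matrix.toEuclideanLin C (v i) = l i • v i

/-- The covariance ellipse `E(C, m, q)` as a curve: centre `m`, principal axes along
orthonormal eigenvectors `v₁, v₂` of `C`, with semi-axes `q √λ₁` and `q √λ₂`. For singular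
positive semidefinite `C` this is a line segment (or a point). -/
def ellipse (C : Matrix (Fin 2) (Fin 2) ℝ) (m : Plane) (q : ℝ) : Set Plane :=
  {z | ∃ (v : OrthonormalBasis (Fin 2) ℝ Plane) (l : Fin 2 → ℝ), IsEigenSystem C v l ∧
    ∃ s : Fin 2 → ℝ, ∑ i, s i ^ 2 = 1 ∧ z = m + ∑ i, (s i * (q * √(l i))) • v i}

/-- The points inside the covariance ellipse `E(C, m, q)`, the curve itself included. -/
def insideEllipse (C : Matrix (Fin 2) (Fin 2) ℝ) (m : Plane) (q : ℝ) : Set Plane :=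
  {z | ∃ (v : OrthonormalBasis (Fin 2) ℝ Plane) (l : Fin 2 → ℝ), IsEigenSystem C v l ∧
    ∃ s : Fin 2 → ℝ, ∑ i, s i ^ 2 ≤ 1 ∧ z = m + ∑ i, (s i * (q * √(l i))) • v i}

/-- The line through the origin with normal vector `a` is tangent to the ellipse `E`, i.e. it
touches `E` and leaves `E` on one side, and `a` points to the side on which `E` lies. -/
def IsTangentNormal (E : Set Plane) (a : Plane) : Prop :=
  a ≠ 0 ∧ (∀ z ∈ E, 0 ≤ inner ℝ a z) ∧ ∃ z ∈ E, inner ℝ a z = 0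

/-- The wedge enclosed by the two tangents through the origin to `E`. It is the double cone
made up of the sector between the two tangents which contains `E` and of the opposite sector:
the normals `a`, `b` of the two (distinct) tangents being oriented towards `E`, it consists of
the `z` with `⟪a, z⟫` and `⟪b, z⟫` both `≥ 0` or both `≤ 0`. -/
def wedge (E : Set Plane) : Set Plane :=
  {z | ∃ a b : Plane, LinearIndependent ℝ ![a, b] ∧ IsTangentNormal E a ∧ IsTangentNormal E b ∧
    ((0 ≤ inner ℝ a z ∧ 0 ≤ inner ℝ b z) ∨ (inner ℝ a z ≤ 0 ∧ inner ℝ b z ≤ 0))}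

/-- The scaling factor `q(t_{n-1}, 1 - α/2)`. -/
def scaling (n : ℕ) (α : ℝ) : ℝ := quantile (studentT (n - 1)) (1 - α / 2)

open Classical in
/-- The region `R_geo` built from the sample `x` at level `1 - α`. If the origin is inside the
ellipse `E(Ĉ, μ̂, q)` it is the whole line, otherwise it is the intersection of the wedge of
the tangents with the vertical line at abscissa `1`. -/
def Rgeo {n : ℕ} (α : ℝ) (x : Fin n → Plane) : Set ℝ :=
  if (0 : Plane) ∈ insideEllipse (sampleCov x) (sampleMean x) (scaling n α) then Set.univ
  else {r | !₂[1, r] ∈ wedge (ellipse (sampleCov x) (sampleMean x) (scaling n α))}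

end FiellerGeo

end

/-! For `a = (-r, 1)` the line of slope `r` is the orthogonal complement of `a`. On the ellipse the
linear form `⟪a, z⟫` has minimum `⟪a, m⟫ - q √(aᵀ C a)` and its values deviate from `⟪a, m⟫` by at
most `q √(aᵀ C a)`. Hence the geometric condition on `r` becomes Fieller's inequality `⟪a, m⟫² ≤ q²
aᵀ C a`, whether the origin is inside or outside the ellipse (`fieller_iff`).

For the sample ellipse, `aᵀ Ĉ a` is the estimated variance of the mean of the projections `⟪a, x
i⟫`, so the inequality says that the two-sided one-sample t-test of mean zero accepts
(`mem_Rgeo_iff_acceptance`). At `r = ρ` the projections are i.i.d. centred normal, their t-statistic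
has the Student law with `n - 1` degrees of freedom (`pi_gaussianReal_acceptance`), and symmetry of
that law gives probability `1 - α` (`studentT_Icc_scaling`).

The wedge needs two distinct tangents, which can fail if the ellipse lies on a line through the
origin. Two independent sample vectors exclude this, and they exist almost surely
(`ae_linearIndependent`). -/

namespace FiellerGeo

/-! ### Support function of the covariance ellipse -/

/-- The quadratic form `aᵀ C a` of a `2 × 2` matrix. -/
noncomputable def quadForm (C : Matrix (Fin 2) (Fin 2) ℝ) (a : Plane) : ℝ :=
  inner ℝ a (Matrix.toEuclideanLin C a)

lemma inner_plane (a b : Plane) : inner ℝ a b = a 0 * b 0 + a 1 * b 1 := by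
  simp [PiLp.inner_apply, Fin.sum_univ_two, mul_comm]

lemma quadForm_eq {C : Matrix (Fin 2) (Fin 2) ℝ} (hC : C.IsHermitian) (a : Plane) :
    quadForm C a = C 0 0 * a 0 ^ 2 + 2 * C 0 1 * a 0 * a 1 + C 1 1 * a 1 ^ 2 := by
  have h : C 1 0 = C 0 1 := by simpa using hC.apply 0 1
  simp only [quadForm, inner_plane, Matrix.toLpLin_apply, Matrix.mulVec, dotProduct,
    Fin.sum_univ_two, h]
  ring

lemma quadForm_nonneg {C : Matrix (Fin 2) (Fin 2) ℝ} (hC : C.PosSemidef) (a : Plane) :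
    0 ≤ quadForm C a := by
  have h := hC.dotProduct_mulVec_nonneg a.ofLp
  rw [quadForm, PiLp.inner_apply]
  simpa [Matrix.toLpLin_apply, dotProduct, mul_comm] using h

lemma IsEigenSystem.quadForm_eq_sum {C : Matrix (Fin 2) (Fin 2) ℝ}
    {v : OrthonormalBasis (Fin 2) ℝ Plane} {l : Fin 2 → ℝ} (h : IsEigenSystem C v l)
    (a : Plane) : quadForm C a = ∑ i, l i * inner ℝ a (v i) ^ 2 := by
  have h1 : Matrix.toEuclideanLin C a = ∑ i, (inner ℝ (v i) a * l i) • v i := by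
    conv_lhs => rw [← v.sum_repr' a]
    simp only [map_sum, map_smul, h _, smul_smul]
  rw [quadForm, h1, inner_sum]
  refine Finset.sum_congr rfl fun i _ => ?_
  rw [inner_smul_right, real_inner_comm a]
  ring

lemma IsEigenSystem.nonneg {C : Matrix (Fin 2) (Fin 2) ℝ} (hC : C.PosSemidef)
    {v : OrthonormalBasis (Fin 2) ℝ Plane} {l : Fin 2 → ℝ} (h : IsEigenSystem C v l)
    (i : Fin 2) : 0 ≤ l i := by
  have h1 := quadForm_nonneg hC (v i)
  rwa [quadForm, h i, inner_smul_right, real_inner_self_eq_norm_sq, v.norm_eq_one, one_pow,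
    mul_one] at h1

lemma exists_isEigenSystem {C : Matrix (Fin 2) (Fin 2) ℝ} (hC : C.IsHermitian) :
    ∃ (v : OrthonormalBasis (Fin 2) ℝ Plane) (l : Fin 2 → ℝ), IsEigenSystem C v l := by
  refine ⟨hC.eigenvectorBasis, hC.eigenvalues, fun i => ?_⟩
  rw [Matrix.toLpLin_apply, hC.mulVec_eigenvectorBasis]
  rfl

lemma ellipse_subset_insideEllipse (C : Matrix (Fin 2) (Fin 2) ℝ) (m : Plane) (q : ℝ) :
    ellipse C m q ⊆ insideEllipse C m q := by
  rintro z ⟨v, l, h, s, hs, hz⟩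
  exact ⟨v, l, h, s, hs.le, hz⟩

/-- Cauchy–Schwarz in eigencoordinates. -/
lemma abs_inner_sub_le_of_mem_insideEllipse {C : Matrix (Fin 2) (Fin 2) ℝ} (hC : C.PosSemidef)
    {m : Plane} {q : ℝ} (hq : 0 ≤ q) {z : Plane} (hz : z ∈ insideEllipse C m q) (a : Plane) :
    |inner ℝ a z - inner ℝ a m| ≤ q * √(quadForm C a) := by
  obtain ⟨v, l, h, s, hs, rfl⟩ := hz
  have hl := h.nonneg hC
  have h1 : inner ℝ a (m + ∑ i, (s i * (q * √(l i))) • v i) - inner ℝ a m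
      = q * ∑ i, s i * (√(l i) * inner ℝ a (v i)) := by
    rw [inner_add_right, inner_sum, Finset.mul_sum, add_sub_cancel_left]
    refine Finset.sum_congr rfl fun i _ => ?_
    rw [inner_smul_right]
    ring
  have h2 : quadForm C a = ∑ i, (√(l i) * inner ℝ a (v i)) ^ 2 := by
    rw [h.quadForm_eq_sum]
    refine Finset.sum_congr rfl fun i _ => ?_
    rw [mul_pow, Real.sq_sqrt (hl i)]
  rw [h1, abs_mul, abs_of_nonneg hq]
  refine mul_le_mul_of_nonneg_left (Real.abs_le_sqrt ?_) hq
  refine (Finset.sum_mul_sq_le_sq_mul_sq _ _ _).trans ?_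
  rw [← h2]
  exact mul_le_of_le_one_left (quadForm_nonneg hC a) hs

/-- Equality case of Cauchy–Schwarz: `s` is the unit vector opposite to `u`, or any unit vector when
`u = 0`. -/
lemma exists_mem_ellipse_inner_eq {C : Matrix (Fin 2) (Fin 2) ℝ} (hC : C.PosSemidef)
    (m : Plane) (q : ℝ) (a : Plane) :
    ∃ z ∈ ellipse C m q, inner ℝ a z = inner ℝ a m - q * √(quadForm C a) := by
  obtain ⟨v, l, h⟩ := exists_isEigenSystem hC.isHermitian
  have hl := h.nonneg hC
  set u : Fin 2 → ℝ := fun i => √(l i) * inner ℝ a (v i) with hu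
  have h2 : quadForm C a = ∑ i, u i ^ 2 := by
    rw [h.quadForm_eq_sum]
    refine Finset.sum_congr rfl fun i _ => ?_
    rw [hu, mul_pow, Real.sq_sqrt (hl i)]
  obtain ⟨s, hs1, hs2⟩ : ∃ s : Fin 2 → ℝ, ∑ i, s i ^ 2 = 1 ∧
      ∑ i, s i * u i = - √(quadForm C a) := by
    rcases (quadForm_nonneg hC a).eq_or_lt with h0 | h0
    · refine ⟨![1, 0], by simp, ?_⟩
      rw [h2, Fin.sum_univ_two] at h0
      have h3 : u 0 = 0 := by nlinarith [sq_nonneg (u 0), sq_nonneg (u 1)]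
      simp only [h2, Fin.sum_univ_two]
      rw [← h0]
      simp [h3]
    · have h4 := Real.sq_sqrt h0.le
      have h5 := (Real.sqrt_pos.2 h0).ne'
      refine ⟨fun i => - u i / √(quadForm C a), ?_, ?_⟩
      · simp only [div_pow, neg_sq]
        rw [← Finset.sum_div, ← h2, h4, div_self h0.ne']
      · have : ∀ i, - u i / √(quadForm C a) * u i = - (u i ^ 2 / √(quadForm C a)) := by
          intro i; ring
        simp only [this]
        rw [Finset.sum_neg_distrib, ← Finset.sum_div, ← h2, Real.div_sqrt]
  refine ⟨_, ⟨v, l, h, s, hs1, rfl⟩, ?_⟩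
  rw [inner_add_right, inner_sum]
  have h6 : ∑ i, inner ℝ a ((s i * (q * √(l i))) • v i) = q * ∑ i, s i * u i := by
    rw [Finset.mul_sum]
    refine Finset.sum_congr rfl fun i _ => ?_
    rw [inner_smul_right, hu]
    ring
  rw [h6, hs2]
  ring

lemma isTangentNormal_ellipse_iff {C : Matrix (Fin 2) (Fin 2) ℝ} (hC : C.PosSemidef)
    {m : Plane} {q : ℝ} (hq : 0 ≤ q) {a : Plane} :
    IsTangentNormal (ellipse C m q) a ↔ a ≠ 0 ∧ inner ℝ a m = q * √(quadForm C a) := by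
  have hle : ∀ z ∈ ellipse C m q, inner ℝ a m - q * √(quadForm C a) ≤ inner ℝ a z := by
    intro z hz
    have := abs_le.1 (abs_inner_sub_le_of_mem_insideEllipse hC hq
      (ellipse_subset_insideEllipse C m q hz) a)
    linarith
  obtain ⟨z₀, hz₀, h₀⟩ := exists_mem_ellipse_inner_eq hC m q a
  refine and_congr_right fun _ => ⟨?_, ?_⟩
  · rintro ⟨h1, z, hz, hz0⟩
    have := hle z hz
    have := h1 z₀ hz₀
    linarith
  · intro h
    exact ⟨fun z hz => by linarith [hle z hz], z₀, hz₀, by linarith⟩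

/-- Duality: a point that no direction separates from the filled ellipse belongs to it. This also
covers singular `C`. -/
lemma zero_mem_insideEllipse_of_forall {C : Matrix (Fin 2) (Fin 2) ℝ} (hC : C.PosSemidef)
    {m : Plane} {q : ℝ} (hq : 0 < q)
    (h : ∀ a : Plane, inner ℝ a m ^ 2 ≤ q ^ 2 * quadForm C a) :
    (0 : Plane) ∈ insideEllipse C m q := by
  obtain ⟨v, l, hv⟩ := exists_isEigenSystem hC.isHermitian
  have hl := hv.nonneg hC
  set c : Fin 2 → ℝ := fun i => inner ℝ (v i) m with hc
  set s : Fin 2 → ℝ := fun i => c i / (q * √(l i)) with hs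
  have hm : m = ∑ i, c i • v i := (v.sum_repr' m).symm
  have hci : ∀ i, c i = s i * (q * √(l i)) := by
    intro i
    rcases (hl i).eq_or_lt with h0 | h0
    -- Here `s i = 0` by division by zero, so `c i` has to vanish; the hypothesis in direction `v i`
    -- forces it.
    · have h1 := h (v i)
      have h2 : quadForm C (v i) = 0 := by
        rw [quadForm, hv i, ← h0, zero_smul, inner_zero_right]
      rw [h2, mul_zero] at h1
      have : c i = 0 := pow_eq_zero_iff two_ne_zero |>.1 (le_antisymm h1 (sq_nonneg _))
      rw [this, ← h0]
      simp
    · have := (Real.sqrt_pos.2 h0).ne'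
      rw [hs]
      field_simp
  -- The direction is `C⁻¹ m / q` (pseudo-inverse if `C` is singular); it turns the hypothesis into
  -- `(∑ s²)² ≤ ∑ s²`, up to the factor `q²`.
  have key := h (∑ i, (s i / √(l i)) • v i)
  have hin : ∀ j, inner ℝ (∑ i, (s i / √(l i)) • v i) (v j) = s j / √(l j) := by
    intro j
    rw [real_inner_comm, v.orthonormal.inner_right_fintype]
  rw [hv.quadForm_eq_sum] at key
  simp only [hin] at key
  have h3 : inner ℝ (∑ i, (s i / √(l i)) • v i) m = q * ∑ i, s i ^ 2 := by
    conv_lhs => rw [hm]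
    rw [inner_sum, Finset.mul_sum]
    refine Finset.sum_congr rfl fun i _ => ?_
    rw [inner_smul_right, hin, hci i]
    rcases (hl i).eq_or_lt with h0 | h0
    · simp [hs, ← h0]
    · have := (Real.sqrt_pos.2 h0).ne'
      field_simp
  have h4 : ∑ i, l i * (s i / √(l i)) ^ 2 = ∑ i, s i ^ 2 := by
    refine Finset.sum_congr rfl fun i _ => ?_
    rcases (hl i).eq_or_lt with h0 | h0
    · simp [hs, ← h0]
    · rw [div_pow, Real.sq_sqrt (hl i)]
      field_simp
  rw [h3, h4, mul_pow] at key
  refine ⟨v, l, hv, fun i => - s i, ?_, ?_⟩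
  · simp only [neg_sq]
    have := le_of_mul_le_mul_left key (by positivity)
    by_contra! hlt
    nlinarith
  · conv_rhs => rw [hm]
    rw [← Finset.sum_add_distrib]
    symm
    refine Finset.sum_eq_zero fun i _ => ?_
    rw [hci i, ← add_smul]
    simp

/-! ### Tangent pairs and the wedge as a quadratic inequality -/

lemma linearIndependent_plane_iff (a b : Plane) :
    LinearIndependent ℝ ![a, b] ↔ a 0 * b 1 - a 1 * b 0 ≠ 0 := by
  rw [LinearIndependent.pair_iff]
  constructor
  · intro h hdet
    have h1 := h (b 1) (-a 1) (by
      ext i; fin_cases i <;> simp <;> linarith)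
    have h0 := h (b 0) (-a 0) (by
      ext i; fin_cases i <;> simp <;> linarith)
    have h2 := h 1 0 (by
      ext i; fin_cases i <;> simp <;> linarith)
    exact one_ne_zero h2.1
  · intro hdet s t hst
    have e0 : s * a 0 + t * b 0 = 0 := by simpa using congrArg (fun z : Plane => z 0) hst
    have e1 : s * a 1 + t * b 1 = 0 := by simpa using congrArg (fun z : Plane => z 1) hst
    constructor
    · refine (mul_eq_zero.1 (?_ : s * (a 0 * b 1 - a 1 * b 0) = 0)).resolve_right hdet
      linear_combination b 1 * e0 - b 0 * e1
    · refine (mul_eq_zero.1 (?_ : t * (a 0 * b 1 - a 1 * b 0) = 0)).resolve_right hdet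
      linear_combination a 0 * e1 - a 1 * e0

/-- If `a` and `b` are the normals of two tangents to the ellipse, the form
`(w ⬝ m)² - q² wᵀ C w`, which vanishes at `a` and at `b`, is a nonpositive multiple of the
product of the two linear forms `z ↦ a ⬝ z` and `z ↦ b ⬝ z`, where `w` is `z` turned by a right
angle. -/
lemma exists_sq_sub_quadForm_eq {C : Matrix (Fin 2) (Fin 2) ℝ} (hC : C.PosSemidef)
    {m : Plane} {q : ℝ} (hq : 0 ≤ q) {a b : Plane} (hab : LinearIndependent ℝ ![a, b])
    (ha : IsTangentNormal (ellipse C m q) a) (hb : IsTangentNormal (ellipse C m q) b) :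
    ∃ c : ℝ, 0 ≤ c ∧ ∀ z : Plane, inner ℝ !₂[-z 1, z 0] m ^ 2 - q ^ 2 * quadForm C !₂[-z 1, z 0]
      = - c * (inner ℝ a z * inner ℝ b z) := by
  have ha2 := ((isTangentNormal_ellipse_iff hC hq).1 ha).2
  have hb2 := ((isTangentNormal_ellipse_iff hC hq).1 hb).2
  have hdet := (linearIndependent_plane_iff a b).1 hab
  have pa : inner ℝ a m ^ 2 = q ^ 2 * quadForm C a := by
    rw [ha2, mul_pow, Real.sq_sqrt (quadForm_nonneg hC a)]
  have pb : inner ℝ b m ^ 2 = q ^ 2 * quadForm C b := by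
    rw [hb2, mul_pow, Real.sq_sqrt (quadForm_nonneg hC b)]
  have na : 0 ≤ inner ℝ a m := ha2 ▸ mul_nonneg hq (Real.sqrt_nonneg _)
  have nb : 0 ≤ inner ℝ b m := hb2 ▸ mul_nonneg hq (Real.sqrt_nonneg _)
  have hd : 0 ≤ C 0 0 * C 1 1 - C 0 1 ^ 2 := by
    have h := hC.det_nonneg
    have h1 : C 1 0 = C 0 1 := by simpa using hC.isHermitian.apply 0 1
    rw [Matrix.det_fin_two, h1] at h
    linarith
  simp only [quadForm_eq hC.isHermitian, inner_plane] at *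
  set e := C 0 0
  set f := C 0 1
  set g := C 1 1
  set a0 := a 0
  set a1 := a 1
  set b0 := b 0
  set b1 := b 1
  set m0 := m 0
  set m1 := m 1
  set S : ℝ := e * a0 * b0 + f * (a0 * b1 + a1 * b0) + g * a1 * b1
  set M : ℝ := (a0 * m0 + a1 * m1) * (b0 * m0 + b1 * m1) with hM
  -- `M - q² S` is the polar form at `(a, b)`. Its sign comes from `det C ≥ 0` together with `M ≥
  -- 0`, which holds because both normals point towards the ellipse.
  have hβ : q ^ 2 * S ≤ M := by
    refine (abs_le_of_sq_le_sq' ?_ (mul_nonneg na nb)).2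
    have : M ^ 2 - (q ^ 2 * S) ^ 2
        = q ^ 4 * ((e * g - f ^ 2) * (a0 * b1 - a1 * b0) ^ 2) := by
      rw [hM, mul_pow, pa, pb]
      ring
    nlinarith [mul_nonneg (by positivity : 0 ≤ q ^ 4)
      (mul_nonneg hd (sq_nonneg (a0 * b1 - a1 * b0)))]
  -- The rotated `z` equals `(⟪a, z⟫ b - ⟪b, z⟫ a) / det(a, b)`; as `a` and `b` are isotropic, only
  -- the cross term survives.
  refine ⟨2 * (M - q ^ 2 * S) / (a0 * b1 - a1 * b0) ^ 2,
    div_nonneg (by linarith) (sq_nonneg _), fun z => ?_⟩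
  rw [neg_mul, div_mul_eq_mul_div, ← neg_div, eq_div_iff (pow_ne_zero 2 hdet)]
  simp only [Matrix.cons_val_zero, Matrix.cons_val_one]
  linear_combination (b0 * z 0 + b1 * z 1) ^ 2 * pa + (a0 * z 0 + a1 * z 1) ^ 2 * pb

lemma sq_le_of_mem_wedge {C : Matrix (Fin 2) (Fin 2) ℝ} (hC : C.PosSemidef)
    {m : Plane} {q : ℝ} (hq : 0 ≤ q) {z : Plane} (hz : z ∈ wedge (ellipse C m q)) :
    inner ℝ !₂[-z 1, z 0] m ^ 2 ≤ q ^ 2 * quadForm C !₂[-z 1, z 0] := by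
  obtain ⟨a, b, hab, ha, hb, h⟩ := hz
  obtain ⟨c, hc, hz⟩ := exists_sq_sub_quadForm_eq hC hq hab ha hb
  have h1 : 0 ≤ inner ℝ a z * inner ℝ b z := by
    rcases h with h | h
    · exact mul_nonneg h.1 h.2
    · exact mul_nonneg_of_nonpos_of_nonpos h.1 h.2
  have := hz z
  nlinarith [mul_nonneg hc h1]

/-- An indefinite binary quadratic form has two independent isotropic vectors. -/
lemma exists_isotropic_pair {A B D : ℝ} {p r : Plane}
    (hp : 0 < A * p 0 ^ 2 + 2 * B * p 0 * p 1 + D * p 1 ^ 2)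
    (hr : A * r 0 ^ 2 + 2 * B * r 0 * r 1 + D * r 1 ^ 2 < 0) :
    ∃ a b : Plane, LinearIndependent ℝ ![a, b] ∧
      A * a 0 ^ 2 + 2 * B * a 0 * a 1 + D * a 1 ^ 2 = 0 ∧
      A * b 0 ^ 2 + 2 * B * b 0 * b 1 + D * b 1 ^ 2 = 0 := by
  set Qp := A * p 0 ^ 2 + 2 * B * p 0 * p 1 + D * p 1 ^ 2 with hQp
  set Qr := A * r 0 ^ 2 + 2 * B * r 0 * r 1 + D * r 1 ^ 2 with hQr
  set β := A * p 0 * r 0 + B * (p 0 * r 1 + p 1 * r 0) + D * p 1 * r 1 with hβ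
  have hδ : 0 < β ^ 2 - Qp * Qr := by nlinarith [sq_nonneg β]
  set d := √(β ^ 2 - Qp * Qr) with hd
  have hd0 : 0 < d := Real.sqrt_pos.2 hδ
  have hd2 : d ^ 2 = β ^ 2 - Qp * Qr := Real.sq_sqrt hδ.le
  have hdet : r 0 * p 1 - r 1 * p 0 ≠ 0 := by
    intro h
    have : β ^ 2 - Qp * Qr = (B ^ 2 - A * D) * (r 0 * p 1 - r 1 * p 0) ^ 2 := by
      rw [hβ, hQp, hQr]; ring
    rw [h] at this
    simp [this] at hδ
  -- At `Qp • r + t • p` the form equals `Qp (t² + 2βt + Qp Qr)`, with roots `t = -β ± d`.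
  refine ⟨Qp • r + (-β + d) • p, Qp • r + (-β - d) • p, ?_, ?_, ?_⟩
  · rw [linearIndependent_plane_iff]
    have : (Qp • r + (-β + d) • p : Plane) 0 * (Qp • r + (-β - d) • p : Plane) 1
        - (Qp • r + (-β + d) • p : Plane) 1 * (Qp • r + (-β - d) • p : Plane) 0
        = - 2 * d * Qp * (r 0 * p 1 - r 1 * p 0) := by
      simp only [PiLp.add_apply, PiLp.smul_apply, smul_eq_mul]
      ring
    rw [this]
    exact mul_ne_zero (mul_ne_zero (mul_ne_zero (by norm_num) hd0.ne') hp.ne') hdet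
  · simp only [PiLp.add_apply, PiLp.smul_apply, smul_eq_mul]
    have : A * (Qp * r 0 + (-β + d) * p 0) ^ 2 + 2 * B * (Qp * r 0 + (-β + d) * p 0) *
        (Qp * r 1 + (-β + d) * p 1) + D * (Qp * r 1 + (-β + d) * p 1) ^ 2
        = Qp ^ 2 * Qr + 2 * Qp * (-β + d) * β + (-β + d) ^ 2 * Qp := by
      rw [hβ, hQr]; linear_combination (-(-β + d) ^ 2) * hQp
    rw [this]
    linear_combination Qp * hd2
  · simp only [PiLp.add_apply, PiLp.smul_apply, smul_eq_mul]
    have : A * (Qp * r 0 + (-β - d) * p 0) ^ 2 + 2 * B * (Qp * r 0 + (-β - d) * p 0) *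
        (Qp * r 1 + (-β - d) * p 1) + D * (Qp * r 1 + (-β - d) * p 1) ^ 2
        = Qp ^ 2 * Qr + 2 * Qp * (-β - d) * β + (-β - d) ^ 2 * Qp := by
      rw [hβ, hQr]; linear_combination (-(-β - d) ^ 2) * hQp
    rw [this]
    linear_combination Qp * hd2

lemma sq_sub_quadForm_eq {C : Matrix (Fin 2) (Fin 2) ℝ} (hC : C.IsHermitian) (m : Plane) (q : ℝ)
    (a : Plane) : inner ℝ a m ^ 2 - q ^ 2 * quadForm C a =
      (m 0 ^ 2 - q ^ 2 * C 0 0) * a 0 ^ 2 + 2 * (m 0 * m 1 - q ^ 2 * C 0 1) * a 0 * a 1 +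
        (m 1 ^ 2 - q ^ 2 * C 1 1) * a 1 ^ 2 := by
  rw [quadForm_eq hC, inner_plane]
  ring

/-- The form does not distinguish `a` from `-a`; the scalar `±1` orients the normal towards the
ellipse. -/
lemma exists_smul_isTangentNormal {C : Matrix (Fin 2) (Fin 2) ℝ} (hC : C.PosSemidef)
    {m : Plane} {q : ℝ} (hq : 0 ≤ q) {a : Plane} (ha : a ≠ 0)
    (h : inner ℝ a m ^ 2 - q ^ 2 * quadForm C a = 0) :
    ∃ c : ℝ, c ≠ 0 ∧ IsTangentNormal (ellipse C m q) (c • a) := by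
  have habs : |inner ℝ a m| = q * √(quadForm C a) := by
    rw [← Real.sqrt_sq_eq_abs, sub_eq_zero.1 h, Real.sqrt_mul (sq_nonneg q), Real.sqrt_sq hq]
  rcases abs_choice (inner ℝ a m) with h1 | h1
  · refine ⟨1, one_ne_zero, ?_⟩
    rw [isTangentNormal_ellipse_iff hC hq, one_smul]
    exact ⟨ha, h1 ▸ habs⟩
  · refine ⟨-1, by norm_num, ?_⟩
    rw [isTangentNormal_ellipse_iff hC hq, neg_one_smul, inner_neg_left, ← h1, habs]
    exact ⟨neg_ne_zero.2 ha, by simp [quadForm]⟩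

/-- Two tangents exist when the origin is outside the ellipse and the ellipse is not contained in
a line through the origin. -/
lemma exists_tangent_pair {C : Matrix (Fin 2) (Fin 2) ℝ} (hC : C.PosSemidef)
    {m : Plane} {q : ℝ} (hq : 0 < q) {p : Plane}
    (hp : q ^ 2 * quadForm C p < inner ℝ p m ^ 2) (hm : 0 < quadForm C !₂[-m 1, m 0]) :
    ∃ a b : Plane, LinearIndependent ℝ ![a, b] ∧ IsTangentNormal (ellipse C m q) a ∧
      IsTangentNormal (ellipse C m q) b := by
  -- The rotated centre is orthogonal to `m`, so the form is negative there; with `p` this makes it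
  -- indefinite.
  have hr : inner ℝ !₂[-m 1, m 0] m ^ 2 - q ^ 2 * quadForm C !₂[-m 1, m 0] < 0 := by
    have : inner ℝ !₂[-m 1, m 0] m = (0 : ℝ) := by
      rw [inner_plane]; simp; ring
    rw [this]
    have := mul_pos (pow_pos hq 2) hm
    linarith
  have hp' := sub_pos.2 hp
  rw [sq_sub_quadForm_eq hC.isHermitian] at hr hp'
  obtain ⟨a, b, hab, ha, hb⟩ := exists_isotropic_pair hp' hr
  rw [← sq_sub_quadForm_eq hC.isHermitian] at ha hb
  obtain ⟨c, hc, ha'⟩ := exists_smul_isTangentNormal (a := a) hC hq.le (hab.ne_zero 0) ha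
  obtain ⟨d, hd, hb'⟩ := exists_smul_isTangentNormal (a := b) hC hq.le (hab.ne_zero 1) hb
  refine ⟨_, _, ?_, ha', hb'⟩
  rw [linearIndependent_plane_iff] at hab ⊢
  have : (c • a) 0 * (d • b) 1 - (c • a) 1 * (d • b) 0 = c * d * (a 0 * b 1 - a 1 * b 0) := by
    simp only [PiLp.smul_apply, smul_eq_mul]
    ring
  rw [this]
  exact mul_ne_zero (mul_ne_zero hc hd) hab

lemma mem_wedge_of_sq_le {C : Matrix (Fin 2) (Fin 2) ℝ} (hC : C.PosSemidef)
    {m : Plane} {q : ℝ} (hq : 0 < q) {p : Plane}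
    (hp : q ^ 2 * quadForm C p < inner ℝ p m ^ 2) (hm : 0 < quadForm C !₂[-m 1, m 0])
    {z : Plane} (hz : inner ℝ !₂[-z 1, z 0] m ^ 2 ≤ q ^ 2 * quadForm C !₂[-z 1, z 0]) :
    z ∈ wedge (ellipse C m q) := by
  obtain ⟨a, b, hab, ha, hb⟩ := exists_tangent_pair hC hq hp hm
  refine ⟨a, b, hab, ha, hb, ?_⟩
  obtain ⟨c, hc, h⟩ := exists_sq_sub_quadForm_eq hC hq.le hab ha hb
  -- With `c = 0` the form would vanish identically, contrary to its positivity at `p`, the rotation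
  -- of `(p 1, -p 0)`.
  have hc' : c ≠ 0 := by
    rintro rfl
    have h1 := h !₂[p 1, - p 0]
    have h2 : (!₂[-(!₂[p 1, - p 0] : Plane) 1, (!₂[p 1, - p 0] : Plane) 0] : Plane) = p := by
      ext i; fin_cases i <;> simp
    rw [h2] at h1
    linarith
  have h1 := h z
  have h2 : 0 ≤ inner ℝ a z * inner ℝ b z := by
    have : 0 ≤ c * (inner ℝ a z * inner ℝ b z) := by linarith
    exact nonneg_of_mul_nonneg_right this (lt_of_le_of_ne hc hc'.symm)
  exact mul_nonneg_iff.1 h2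

/-- Fieller's inequality describes the slopes of the lines in the wedge. -/
lemma fieller_iff {C : Matrix (Fin 2) (Fin 2) ℝ} (hC : C.PosSemidef)
    {m : Plane} {q : ℝ} (hq : 0 < q) (hm : m ≠ 0 → 0 < quadForm C !₂[-m 1, m 0]) (r : ℝ) :
    ((0 : Plane) ∈ insideEllipse C m q ∨ !₂[1, r] ∈ wedge (ellipse C m q)) ↔
      inner ℝ !₂[-r, 1] m ^ 2 ≤ q ^ 2 * quadForm C !₂[-r, 1] := by
  constructor
  · rintro (h | h)
    · have := abs_inner_sub_le_of_mem_insideEllipse hC hq.le h !₂[-r, 1]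
      rw [inner_zero_right, zero_sub, abs_neg] at this
      rw [← sq_abs]
      refine (pow_le_pow_left₀ (abs_nonneg _) this 2).trans_eq ?_
      rw [mul_pow, Real.sq_sqrt (quadForm_nonneg hC _)]
    · simpa using sq_le_of_mem_wedge hC hq.le h
  · intro h
    by_cases h0 : (0 : Plane) ∈ insideEllipse C m q
    · exact Or.inl h0
    right
    obtain ⟨p, hp⟩ : ∃ p : Plane, q ^ 2 * quadForm C p < inner ℝ p m ^ 2 := by
      by_contra! hcon
      exact h0 (zero_mem_insideEllipse_of_forall hC hq hcon)
    have hm0 : m ≠ 0 := by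
      rintro rfl
      rw [inner_zero_right] at hp
      have := mul_nonneg (sq_nonneg q) (quadForm_nonneg hC p)
      simp at hp
      linarith
    exact mem_wedge_of_sq_le hC hq hp (hm hm0) (by simpa using h)

/-! ### Sample mean and covariance along a direction -/

lemma sampleCov_isHermitian {n : ℕ} (x : Fin n → Plane) : (sampleCov x).IsHermitian := by
  ext j k
  simp [sampleCov, mul_comm]

lemma inner_sampleMean {n : ℕ} (a : Plane) (x : Fin n → Plane) :
    inner ℝ a (sampleMean x) = (1 / (n : ℝ)) * ∑ i, inner ℝ a (x i) := by
  rw [sampleMean, inner_smul_right, inner_sum]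

lemma quadForm_sampleCov {n : ℕ} (x : Fin n → Plane) (a : Plane) :
    quadForm (sampleCov x) a = (1 / (n : ℝ)) * (1 / ((n : ℝ) - 1)) *
      ∑ i, (inner ℝ a (x i) - inner ℝ a (sampleMean x)) ^ 2 := by
  rw [quadForm_eq (sampleCov_isHermitian x)]
  simp only [sampleCov, Matrix.of_apply, inner_plane, Finset.mul_sum, Finset.sum_mul,
    ← Finset.sum_add_distrib]
  refine Finset.sum_congr rfl fun i _ => ?_
  ring

lemma sampleCov_posSemidef {n : ℕ} (hn : 2 ≤ n) (x : Fin n → Plane) :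
    (sampleCov x).PosSemidef := by
  refine Matrix.PosSemidef.of_dotProduct_mulVec_nonneg (sampleCov_isHermitian x) fun v => ?_
  have h := quadForm_sampleCov x (WithLp.toLp 2 v)
  have hn' : (2 : ℝ) ≤ n := by exact_mod_cast hn
  have h0 : 0 ≤ quadForm (sampleCov x) (WithLp.toLp 2 v) := by
    rw [h]
    refine mul_nonneg (mul_nonneg ?_ ?_) (Finset.sum_nonneg fun i _ => sq_nonneg _)
    · positivity
    · exact one_div_nonneg.2 (by linarith)
  rw [quadForm, PiLp.inner_apply] at h0
  simpa [Matrix.toLpLin_apply, dotProduct, mul_comm] using h0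

/-- If the value were zero, every `x i` would lie on the line spanned by the mean. -/
lemma quadForm_sampleCov_rotate_pos {n : ℕ} (hn : 2 ≤ n) (x : Fin n → Plane) {i j : Fin n}
    (hij : LinearIndependent ℝ ![x i, x j]) (hm : sampleMean x ≠ 0) :
    0 < quadForm (sampleCov x) !₂[-sampleMean x 1, sampleMean x 0] := by
  set m := sampleMean x with hm_def
  have hn' : (2 : ℝ) ≤ n := by exact_mod_cast hn
  rw [quadForm_sampleCov, ← hm_def]
  have h0 : inner ℝ (!₂[-m 1, m 0] : Plane) m = 0 := by
    rw [inner_plane]; simp; ring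
  simp only [h0, sub_zero]
  refine mul_pos (mul_pos (by positivity) (one_div_pos.2 (by linarith))) ?_
  refine lt_of_le_of_ne (Finset.sum_nonneg fun i _ => sq_nonneg _) fun hs => hm ?_
  have hz := (Finset.sum_eq_zero_iff_of_nonneg fun i _ => sq_nonneg _).1 hs.symm
  have hi : -m 1 * x i 0 + m 0 * x i 1 = 0 := by
    simpa [inner_plane] using hz i (Finset.mem_univ _)
  have hj : -m 1 * x j 0 + m 0 * x j 1 = 0 := by
    simpa [inner_plane] using hz j (Finset.mem_univ _)
  rw [linearIndependent_plane_iff] at hij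
  ext k
  fin_cases k
  · refine (mul_eq_zero.1 (?_ : m 0 * (x i 0 * x j 1 - x i 1 * x j 0) = 0)).resolve_right hij
    linear_combination x i 0 * hj - x j 0 * hi
  · refine (mul_eq_zero.1 (?_ : m 1 * (x i 0 * x j 1 - x i 1 * x j 0) = 0)).resolve_right hij
    linear_combination x i 1 * hj - x j 1 * hi

/-- For a sample that does not lie on a line through the origin, `r` belongs to the geometric
region iff the one-sample `t`-test of the projections `x_{i,2} - r x_{i,1}` accepts mean zero. -/
lemma mem_Rgeo_iff {n : ℕ} (hn : 2 ≤ n) {α : ℝ} (hq : 0 < scaling n α) (x : Fin n → Plane)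
    {i j : Fin n} (hij : LinearIndependent ℝ ![x i, x j]) (r : ℝ) :
    r ∈ Rgeo α x ↔
      inner ℝ !₂[-r, 1] (sampleMean x) ^ 2 ≤
        scaling n α ^ 2 * quadForm (sampleCov x) !₂[-r, 1] := by
  rw [← fieller_iff (sampleCov_posSemidef hn x) hq (quadForm_sampleCov_rotate_pos hn x hij)]
  unfold Rgeo
  split_ifs with h <;> simp [h]

/-! ### The Student law: continuity, symmetry, quantiles -/

instance nullSingletonClass_gaussianReal_std : NullSingletonClass (gaussianReal 0 1) := nullSingletonClass_gaussianReal one_ne_zero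

lemma measurable_studentRatio (f : ℕ) :
    Measurable fun z : ℝ × (Fin f → ℝ) => z.1 / √((∑ i, z.2 i ^ 2) / (f : ℝ)) := by
  fun_prop

instance isProbabilityMeasure_studentT (f : ℕ) : IsProbabilityMeasure (studentT f) :=
  Measure.isProbabilityMeasure_map (measurable_studentRatio f).aemeasurable

lemma ae_sum_sq_pos {f : ℕ} (hf : f ≠ 0) :
    ∀ᵐ y ∂Measure.pi fun _ : Fin f => gaussianReal 0 1, 0 < ∑ i, y i ^ 2 := by
  have : NeZero f := ⟨hf⟩
  have h : ∀ᵐ t ∂gaussianReal 0 1, t ≠ 0 := by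
    simp [ae_iff, measure_singleton]
  have h1 := (measurePreserving_eval (fun _ : Fin f => gaussianReal 0 1)
    0).quasiMeasurePreserving.ae h
  filter_upwards [h1] with y hy
  exact Finset.sum_pos' (fun i _ => sq_nonneg _) ⟨0, Finset.mem_univ _, by positivity⟩

/-- Fubini: once the denominator is fixed and positive, a single value of the numerator produces
`t`. -/
lemma nullSingletonClass_studentT {f : ℕ} (hf : f ≠ 0) : NullSingletonClass (studentT f) := by
  refine ⟨fun t => ?_⟩
  have hm := measurable_studentRatio f (measurableSet_singleton t)
  rw [studentT, Measure.map_apply (measurable_studentRatio f) (measurableSet_singleton t),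
    Measure.prod_apply_symm hm, lintegral_eq_zero_iff (measurable_measure_prodMk_right hm)]
  filter_upwards [ae_sum_sq_pos hf] with y hy
  have hd : √((∑ i, y i ^ 2) / (f : ℝ)) ≠ 0 := by positivity
  refine measure_mono_null (t := {t * √((∑ i, y i ^ 2) / (f : ℝ))}) (fun z hz => ?_)
    (measure_singleton _)
  exact (div_eq_iff hd).1 hz

lemma studentT_map_neg (f : ℕ) : (studentT f).map Neg.neg = studentT f := by
  have hg : MeasurePreserving (Neg.neg : ℝ → ℝ) (gaussianReal 0 1) (gaussianReal 0 1) :=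
    ⟨measurable_neg, by simpa using gaussianReal_map_neg (μ := 0) (v := 1)⟩
  have h := (hg.prod (MeasurePreserving.id
    (Measure.pi fun _ : Fin f => gaussianReal 0 1))).map_eq
  rw [studentT, Measure.map_map measurable_neg (measurable_studentRatio f)]
  conv_rhs => rw [← h, Measure.map_map (measurable_studentRatio f)
    (measurable_neg.prodMap measurable_id)]
  congr 1
  ext z
  simp [neg_div]

lemma continuous_cdf (ν : Measure ℝ) [IsProbabilityMeasure ν] [NullSingletonClass ν] :
    Continuous (cdf ν) := by
  refine continuous_iff_continuousAt.2 fun t => continuousAt_iff_continuous_left_right.2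
    ⟨?_, (cdf ν).right_continuous t⟩
  have h := measure_singleton (μ := ν) t
  rw [← measure_cdf ν, StieltjesFunction.measure_singleton, ENNReal.ofReal_eq_zero] at h
  rw [← continuousWithinAt_Iio_iff_Iic, (monotone_cdf ν).continuousWithinAt_Iio_iff_leftLim_eq]
  exact le_antisymm ((monotone_cdf ν).leftLim_le le_rfl) (by linarith)

/-- The value of the distribution function at a quantile of a continuous law. -/
lemma cdf_quantile {ν : Measure ℝ} [IsProbabilityMeasure ν] [NullSingletonClass ν] {p : ℝ}
    (hp0 : 0 < p) (hp1 : p < 1) : cdf ν (quantile ν p) = p := by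
  have hc := continuous_cdf ν
  obtain ⟨a, ha⟩ := ((tendsto_cdf_atBot ν).eventually_lt_const hp0).exists
  obtain ⟨b, hb⟩ := ((tendsto_cdf_atTop ν).eventually_const_lt hp1).exists
  have hne : {x : ℝ | cdf ν x = p}.Nonempty :=
    mem_range_of_exists_le_of_exists_ge hc ⟨a, ha.le⟩ ⟨b, hb.le⟩
  -- A nonempty closed set bounded below contains its `sInf`.
  have hbdd : BddBelow {x : ℝ | cdf ν x = p} := by
    refine ⟨a, fun x hx => ?_⟩
    by_contra! hlt
    have := monotone_cdf ν hlt.le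
    have hx' : cdf ν x = p := hx
    linarith
  exact (isClosed_eq hc continuous_const).csInf_mem hne hbdd

lemma cdf_neg_of_symmetric {ν : Measure ℝ} [IsProbabilityMeasure ν] [NullSingletonClass ν]
    (hs : ν.map Neg.neg = ν) (t : ℝ) : cdf ν (-t) = 1 - cdf ν t := by
  have h1 : ν.real (Set.Iic (-t)) = ν.real (Set.Ici t) := by
    conv_lhs => rw [← hs]
    rw [map_measureReal_apply measurable_neg measurableSet_Iic]
    congr 1
    ext x
    simp
  have h2 : ν.real (Set.Ici t) = ν.real (Set.Ioi t) := (measureReal_congr Ioi_ae_eq_Ici).symm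
  rw [cdf_eq_real, cdf_eq_real, h1, h2, ← Set.compl_Iic, probReal_compl_eq_one_sub measurableSet_Iic]

/-- By symmetry the distribution function is `1/2` at zero, below `1 - α/2`. -/
lemma scaling_pos {n : ℕ} (hn : 2 ≤ n) {α : ℝ} (hα0 : 0 < α) (hα1 : α < 1) :
    0 < scaling n α := by
  have hν := nullSingletonClass_studentT (f := n - 1) (by lia)
  have h := cdf_quantile (ν := studentT (n - 1)) (p := 1 - α / 2) (by linarith) (by linarith)
  have h0 := cdf_neg_of_symmetric (ν := studentT (n - 1)) (studentT_map_neg _) 0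
  rw [neg_zero] at h0
  by_contra! hle
  have := monotone_cdf (studentT (n - 1)) hle
  rw [scaling, h] at this
  linarith

lemma studentT_Icc_scaling {n : ℕ} (hn : 2 ≤ n) {α : ℝ} (hα0 : 0 < α) (hα1 : α < 1) :
    studentT (n - 1) (Set.Icc (-scaling n α) (scaling n α)) = ENNReal.ofReal (1 - α) := by
  have hν := nullSingletonClass_studentT (f := n - 1) (by lia)
  have h := cdf_quantile (ν := studentT (n - 1)) (p := 1 - α / 2) (by linarith) (by linarith)
  have h' := cdf_neg_of_symmetric (ν := studentT (n - 1)) (studentT_map_neg _) (scaling n α)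
  rw [← scaling] at h
  rw [← measure_congr Ioc_ae_eq_Icc, ← measure_cdf (studentT (n - 1)),
    StieltjesFunction.measure_Ioc, h', h]
  congr 1
  ring

/-! ### Gaussian projections and nondegenerate samples -/

lemma quadForm_pos {C : Matrix (Fin 2) (Fin 2) ℝ} (hC : C.PosDef) {a : Plane} (ha : a ≠ 0) :
    0 < quadForm C a := by
  have h := hC.dotProduct_mulVec_pos (x := a.ofLp) (by simpa using ha)
  rw [quadForm, PiLp.inner_apply]
  simpa [Matrix.toLpLin_apply, dotProduct, mul_comm] using h

lemma map_inner_multivariateGaussian (μ a : Plane) {C : Matrix (Fin 2) (Fin 2) ℝ}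
    (hC : C.PosSemidef) : (multivariateGaussian μ C).map (fun z => inner ℝ a z) =
      gaussianReal (inner ℝ a μ) (quadForm C a).toNNReal := by
  have h := IsGaussian.map_eq_gaussianReal (μ := multivariateGaussian μ C) (innerSL ℝ a)
  have hv : Var[fun z => inner ℝ a z; multivariateGaussian μ C] = quadForm C a := by
    rw [← covarianceBilin_self IsGaussian.memLp_two_id, covarianceBilin_multivariateGaussian hC,
      quadForm, PiLp.inner_apply]
    simp [Matrix.toLpLin_apply, dotProduct, mul_comm]
  have hm : ∫ z, inner ℝ a z ∂multivariateGaussian μ C = inner ℝ a μ := by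
    have := (innerSL ℝ a).integral_comp_id_comm
      (IsGaussian.integrable_id (μ := multivariateGaussian μ C))
    simpa using this
  simp only [innerSL_apply_apply] at h
  rw [hm] at h
  change _ = gaussianReal _ (Var[fun z => inner ℝ a z; multivariateGaussian μ C]).toNNReal at h
  rw [hv] at h
  exact h

lemma ae_inner_ne_zero (μ : Plane) {C : Matrix (Fin 2) (Fin 2) ℝ} (hC : C.PosDef) {a : Plane}
    (ha : a ≠ 0) : ∀ᵐ z ∂multivariateGaussian μ C, inner ℝ a z ≠ 0 := by
  have hv : (quadForm C a).toNNReal ≠ 0 := by simpa using quadForm_pos hC ha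
  have := nullSingletonClass_gaussianReal (μ := inner ℝ a μ) hv
  have h : ∀ᵐ t ∂(multivariateGaussian μ C).map (fun z => inner ℝ a z), t ≠ 0 := by
    rw [map_inner_multivariateGaussian μ a hC.posSemidef]
    simp [ae_iff, measure_singleton]
  exact ae_of_ae_map (f := fun z => inner ℝ a z) (by fun_prop) h

/-- For fixed `x ≠ 0` the determinant is a nonzero linear form in `y`, almost surely nonzero under a
nondegenerate Gaussian. -/
lemma ae_linearIndependent {μ : Plane} {C : Matrix (Fin 2) (Fin 2) ℝ} (hC : C.PosDef)
    {Ω : Type*} [MeasurableSpace Ω] {P : Measure Ω} [IsProbabilityMeasure P]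
    {X Y : Ω → Plane} (hX : HasLaw X (multivariateGaussian μ C) P)
    (hY : HasLaw Y (multivariateGaussian μ C) P) (hXY : IndepFun X Y P) :
    ∀ᵐ ω ∂P, LinearIndependent ℝ ![X ω, Y ω] := by
  have hm : MeasurableSet {z : Plane × Plane | z.1 0 * z.2 1 - z.1 1 * z.2 0 ≠ 0} :=
    (measurableSet_eq_fun (by fun_prop) (by fun_prop)).compl
  have h : ∀ᵐ z ∂(multivariateGaussian μ C).prod (multivariateGaussian μ C),
      z.1 0 * z.2 1 - z.1 1 * z.2 0 ≠ 0 := by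
    rw [Measure.ae_prod_iff_ae_ae hm]
    have h0 : (!₂[1, 0] : Plane) ≠ 0 := fun h => by
      simpa using congrArg (fun z : Plane => z 0) h
    filter_upwards [ae_inner_ne_zero μ hC h0] with x hx
    have hx' : (!₂[-x 1, x 0] : Plane) ≠ 0 := fun h => by
      have := congrArg (fun z : Plane => z 1) h
      simp [inner_plane] at hx this
      exact hx this
    filter_upwards [ae_inner_ne_zero μ hC hx'] with y hy
    rw [inner_plane] at hy
    contrapose! hy
    simp
    linarith
  have h2 := ((hXY.hasLaw_prod hX hY).ae_iff (p := fun z : Plane × Plane =>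
    z.1 0 * z.2 1 - z.1 1 * z.2 0 ≠ 0) (measurableSet_setOfPred.1 hm)).2 h
  filter_upwards [h2] with ω hω
  exact (linearIndependent_plane_iff _ _).2 hω

/-! ### Law of the t-test by rotation -/

/-- An orthonormal basis whose first vector is proportional to the all-ones vector. -/
lemma exists_orthonormalBasis_diagonal (k : ℕ) :
    ∃ b : OrthonormalBasis (Fin (k + 1)) ℝ (EuclideanSpace ℝ (Fin (k + 1))),
      ∀ i, b 0 i = 1 / √((k : ℝ) + 1) := by
  set e : EuclideanSpace ℝ (Fin (k + 1)) := WithLp.toLp 2 fun _ => 1 / √((k : ℝ) + 1)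
  have he : ‖e‖ = 1 := by
    have : (0 : ℝ) ≤ (k : ℝ) + 1 := by positivity
    have h' : ((k : ℝ) + 1) ≠ 0 := by positivity
    rw [EuclideanSpace.norm_eq]
    simp [e, Real.sq_sqrt this, h']
  obtain ⟨b, hb⟩ := Orthonormal.exists_orthonormalBasis_extension_of_card_eq (𝕜 := ℝ)
    (v := fun _ : Fin (k + 1) => e) (s := {0}) (by simp) (by
      constructor
      · intro i; simpa using he
      · intro i j hij; exact absurd (Subsingleton.elim i j) hij)
  exact ⟨b, fun i => by rw [hb 0 rfl]⟩

lemma sum_sub_mean_sq {n : ℕ} (hn : n ≠ 0) (y : Fin n → ℝ) :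
    ∑ i, (y i - 1 / (n : ℝ) * ∑ j, y j) ^ 2 = ∑ i, y i ^ 2 - (∑ i, y i) ^ 2 / n := by
  have hn' : (n : ℝ) ≠ 0 := by exact_mod_cast hn
  simp only [sub_sq, Finset.sum_add_distrib, Finset.sum_sub_distrib, ← Finset.mul_sum,
    ← Finset.sum_mul, Finset.sum_const, Finset.card_univ, Fintype.card_fin, nsmul_eq_mul]
  field_simp
  ring

/-- The acceptance region of the two-sided one-sample `t`-test of mean zero with critical
value `q`. -/
def acceptance (n : ℕ) (q : ℝ) : Set (Fin n → ℝ) :=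
  {y | (1 / (n : ℝ) * ∑ i, y i) ^ 2 ≤ q ^ 2 * (1 / (n : ℝ) * (1 / ((n : ℝ) - 1)) *
    ∑ i, (y i - 1 / (n : ℝ) * ∑ j, y j) ^ 2)}

lemma measurableSet_acceptance (n : ℕ) (q : ℝ) : MeasurableSet (acceptance n q) :=
  measurableSet_le (by fun_prop) (by fun_prop)

/-- Scale invariance removes the unknown variance of the projections. -/
lemma smul_mem_acceptance_iff {n : ℕ} {q c : ℝ} (hc : c ≠ 0) (y : Fin n → ℝ) :
    (fun i => c * y i) ∈ acceptance n q ↔ y ∈ acceptance n q := by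
  have h1 : ∀ i, c * y i - 1 / (n : ℝ) * (c * ∑ j, y j)
      = c * (y i - 1 / (n : ℝ) * ∑ j, y j) := fun i => by ring
  simp only [acceptance, Set.mem_ofPred_eq, ← Finset.mul_sum, h1, mul_pow]
  refine Iff.trans (iff_of_eq ?_) (mul_le_mul_iff_right₀ (by positivity : 0 < c ^ 2))
  congr 1 <;> ring

/-- In the rotated coordinates `x 0` is `√n` times the mean and the other `k = n - 1` squares add up
to the squared deviations. -/
lemma mem_acceptance_sum_smul_iff {k : ℕ} (q : ℝ)
    {b : OrthonormalBasis (Fin (k + 1)) ℝ (EuclideanSpace ℝ (Fin (k + 1)))}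
    (hb : ∀ i, b 0 i = 1 / √((k : ℝ) + 1)) (x : Fin (k + 1) → ℝ) :
    (∑ i, x i • b i).ofLp ∈ acceptance (k + 1) q ↔
      x 0 ^ 2 ≤ q ^ 2 * ((∑ i : Fin k, x i.succ ^ 2) / k) := by
  set y := ∑ i, x i • b i with hy
  have hn : (0 : ℝ) < (k : ℝ) + 1 := by positivity
  have hs := Real.sqrt_pos.2 hn
  have hx0 : inner ℝ (b 0) y = x 0 := b.orthonormal.inner_right_fintype x 0
  have hsum : ∑ i, y i = √((k : ℝ) + 1) * x 0 := by
    rw [← hx0, PiLp.inner_apply]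
    simp only [hb, RCLike.inner_apply, conj_trivial, ← Finset.sum_mul]
    field_simp
  have hsq : ∑ i, y i ^ 2 = x 0 ^ 2 + ∑ i : Fin k, x i.succ ^ 2 := by
    have h1 : ‖y‖ ^ 2 = ∑ i, x i ^ 2 := by
      rw [← real_inner_self_eq_norm_sq, hy, b.orthonormal.inner_sum]
      simp [sq]
    rw [← Fin.sum_univ_succ (fun i => x i ^ 2), ← h1, EuclideanSpace.real_norm_sq_eq]
  rw [acceptance, Set.mem_ofPred_eq, sum_sub_mean_sq (by lia), hsum, hsq]
  push_cast
  rw [mul_pow, mul_pow, Real.sq_sqrt hn.le, ← mul_le_mul_iff_right₀ hn]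
  field_simp
  ring_nf

/-- The standard Gaussian is rotation invariant, so the rotated coordinates are again independent
standard normals, as in `studentT`. -/
lemma pi_gaussianReal_acceptance {k : ℕ} (hk : k ≠ 0) {q : ℝ} (hq : 0 ≤ q) :
    (Measure.pi fun _ : Fin (k + 1) => gaussianReal 0 1) (acceptance (k + 1) q) =
      studentT k (Set.Icc (-q) q) := by
  obtain ⟨b, hb⟩ := exists_orthonormalBasis_diagonal k
  have hS : MeasurableSet
      (WithLp.ofLp ⁻¹' acceptance (k + 1) q : Set (EuclideanSpace ℝ (Fin (k + 1)))) :=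
    (PiLp.continuous_ofLp 2 _).measurable (measurableSet_acceptance _ _)
  have hlaw := (map_pi_eq_stdGaussian (ι := Fin (k + 1))).trans
    (stdGaussian_eq_map_pi_orthonormalBasis b)
  have h1 := congrArg (fun ν => ν (WithLp.ofLp ⁻¹' acceptance (k + 1) q)) hlaw
  simp only at h1
  rw [Measure.map_apply (by fun_prop) hS, Measure.map_apply (by fun_prop) hS] at h1
  have h2 : (fun x : Fin (k + 1) → ℝ => ∑ i, x i • b i) ⁻¹'
      (WithLp.ofLp ⁻¹' acceptance (k + 1) q) =
      MeasurableEquiv.piFinSuccAbove (fun _ => ℝ) 0 ⁻¹'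
        {z | z.1 ^ 2 ≤ q ^ 2 * ((∑ i, z.2 i ^ 2) / k)} := by
    ext x
    exact mem_acceptance_sum_smul_iff q hb x
  have hT : MeasurableSet
      {z : ℝ × (Fin k → ℝ) | z.1 ^ 2 ≤ q ^ 2 * ((∑ i, z.2 i ^ 2) / k)} :=
    measurableSet_le (by fun_prop) (by fun_prop)
  change (Measure.pi fun _ : Fin (k + 1) => gaussianReal 0 1) (acceptance (k + 1) q) = _ at h1
  rw [h1, h2, (measurePreserving_piFinSuccAbove (fun _ : Fin (k + 1) => gaussianReal 0 1)
    0).measure_preimage hT.nullMeasurableSet, studentT,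
    Measure.map_apply (measurable_studentRatio k) measurableSet_Icc]
  refine measure_congr ?_
  filter_upwards [Measure.quasiMeasurePreserving_snd.ae (ae_sum_sq_pos hk)] with z hz
  have hd : 0 < (∑ i, z.2 i ^ 2) / (k : ℝ) := by positivity
  refine propext (?_ : z.1 ^ 2 ≤ _ ↔ _ ∈ Set.Icc _ _)
  rw [Set.mem_Icc, ← abs_le, ← sq_le_sq₀ (abs_nonneg _) hq, sq_abs, div_pow,
    Real.sq_sqrt hd.le, div_le_iff₀ hd]

lemma mem_Rgeo_iff_acceptance {n : ℕ} (hn : 2 ≤ n) {α : ℝ} (hq : 0 < scaling n α)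
    (x : Fin n → Plane) {i j : Fin n} (hij : LinearIndependent ℝ ![x i, x j]) (r : ℝ) :
    r ∈ Rgeo α x ↔ (fun i => inner ℝ !₂[-r, 1] (x i)) ∈ acceptance n (scaling n α) := by
  rw [mem_Rgeo_iff hn hq x hij, quadForm_sampleCov]
  simp only [inner_sampleMean]
  rfl

/-- The law of a sample of centred Gaussian variables, standardized. -/
lemma hasLaw_standardized_inner {n : ℕ} {μ a : Plane} {C : Matrix (Fin 2) (Fin 2) ℝ}
    (hC : C.PosDef) (ha : a ≠ 0) (haμ : inner ℝ a μ = 0)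
    {Ω : Type*} [MeasurableSpace Ω] {P : Measure Ω} {Z : Fin n → Ω → Plane}
    (hlaw : ∀ i, HasLaw (Z i) (multivariateGaussian μ C) P) (hindep : iIndepFun Z P) :
    HasLaw (fun ω i => (√(quadForm C a))⁻¹ * inner ℝ a (Z i ω))
      (Measure.pi fun _ : Fin n => gaussianReal 0 1) P := by
  have hv := quadForm_pos hC ha
  refine iIndepFun.hasLaw_pi (X := fun i ω => (√(quadForm C a))⁻¹ * inner ℝ a (Z i ω))
    (fun i => ?_) (hindep.comp (fun _ z => (√(quadForm C a))⁻¹ * inner ℝ a z) fun _ => by fun_prop)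
  have h1 : HasLaw (fun z => inner ℝ a z) (gaussianReal 0 (quadForm C a).toNNReal)
      (multivariateGaussian μ C) :=
    ⟨by fun_prop, by rw [map_inner_multivariateGaussian μ a hC.posSemidef, haμ]⟩
  have h2 := gaussianReal_const_mul (h1.fun_comp (hlaw i)) (√(quadForm C a))⁻¹
  convert h2 using 2
  · simp
  · ext
    simp [inv_pow, Real.sq_sqrt hv.le, Real.coe_toNNReal _ hv.le, hv.ne']

end FiellerGeo

theorem mainTheorem1 (n : ℕ) (hn : 2 ≤ n) (α : ℝ) (hα0 : 0 < α) (hα1 : α < 1)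
    (μ : FiellerGeo.Plane) (hμ : μ 0 ≠ 0)
    (C : Matrix (Fin 2) (Fin 2) ℝ) (hC : C.PosDef)
    {Ω : Type*} [MeasurableSpace Ω] (P : Measure Ω) [IsProbabilityMeasure P]
    (Z : Fin n → Ω → FiellerGeo.Plane)
    (hlaw : ∀ i, HasLaw (Z i) (multivariateGaussian μ C) P)
    (hindep : iIndepFun Z P) :
    NullMeasurableSet {ω | μ 1 / μ 0 ∈ FiellerGeo.Rgeo α (fun i => Z i ω)} P ∧
    P {ω | μ 1 / μ 0 ∈ FiellerGeo.Rgeo α (fun i => Z i ω)} = ENNReal.ofReal (1 - α) := by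
  have hq := FiellerGeo.scaling_pos hn hα0 hα1
  set a : FiellerGeo.Plane := !₂[-(μ 1 / μ 0), 1] with ha_def
  have ha : a ≠ 0 := fun h => by
    simpa [ha_def] using congrArg (fun z : FiellerGeo.Plane => z 1) h
  have haμ : inner ℝ a μ = 0 := by
    rw [FiellerGeo.inner_plane]
    simp [ha_def, hμ]
  have hc := inv_ne_zero (Real.sqrt_pos.2 (FiellerGeo.quadForm_pos hC ha)).ne'
  have hW := FiellerGeo.hasLaw_standardized_inner hC ha haμ hlaw hindep
  set W : Ω → Fin n → ℝ := fun ω i => (√(FiellerGeo.quadForm C a))⁻¹ * inner ℝ a (Z i ω)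
  have hS := FiellerGeo.measurableSet_acceptance n (FiellerGeo.scaling n α)
  have hind : IndepFun (Z ⟨0, by lia⟩) (Z ⟨1, by lia⟩) P := hindep.indepFun (by simp)
  -- Agreement holds off the null set where the first two sample vectors are dependent;
  -- null-measurability is transferred along it.
  have hae : {ω | μ 1 / μ 0 ∈ FiellerGeo.Rgeo α (fun i => Z i ω)} =ᵐ[P]
      W ⁻¹' FiellerGeo.acceptance n (FiellerGeo.scaling n α) := by
    filter_upwards [FiellerGeo.ae_linearIndependent hC (hlaw _) (hlaw _) hind] with ω hω
    exact propext ((FiellerGeo.mem_Rgeo_iff_acceptance hn hq (fun i => Z i ω) hω _).trans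
      (FiellerGeo.smul_mem_acceptance_iff hc _).symm)
  refine ⟨(hW.aemeasurable.nullMeasurableSet_preimage hS).congr hae.symm, ?_⟩
  rw [measure_congr hae, ← Measure.map_apply_of_aemeasurable hW.aemeasurable hS, hW.map_eq]
  obtain ⟨k, rfl⟩ : ∃ k, n = k + 1 := ⟨n - 1, by lia⟩
  rw [FiellerGeo.pi_gaussianReal_acceptance (by lia) hq.le]
  exact FiellerGeo.studentT_Icc_scaling hn hα0 hα1
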